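/- Let $S^1=\mathbb R/2\pi\mathbb Z$, $L^2=L^2(S^1,d\theta/2\pi)$, $e_n(\theta)=e^{in\theta}$, and $\mathcal T_{\le N}=\mathrm{span}\{e_n:|n|\le N\}$. For a real weight $w\in W^{1,\infty}(S^1)$ with $0<w_-\le w\le w_+<\infty$ a.e. and for $\lambda>0$, put \[ \langle f,g\rangle_w=\int f\,\overline g\,w\,\frac{d\theta}{2\pi}\quad(f,g\in L^2),\qquad \langle f,g\rangle_{w,\lambda}=\langle f,g\rangle_w+\lambda\int f'\,\overline{g'}\,\frac{d\theta}{2\pi}\quad(f,g\in H^1(S^1)). \] Let $Q_N^{(0)}$ be the orthogonal projector of $L^2$ onto $\mathcal T_{\le N}$ with respect to $\langle\cdot,\cdot\rangle_w$, and let $Q_N^{(\lambda)}$ be the bounded operator on $L^2$ that extends the orthogonal projector of $H^1(S^1)$ onto $\mathcal T_{\le N}$ with respect to $\langle\cdot,\cdot\rangle_{w,\lambda}$. Let $(u_k^{(0)})_{k=1}^{2N+1}$ and $(u_k^{(\lambda)})_{k=1}^{2N+1}$ be the orthonormal bases of $\mathcal T_{\le N}$ obtained by Gram–Schmidt orthonormalization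 (with positive normalization factors) of the ordered basis $(e_{-N},\dots,e_N)$ with respect to $\langle\cdot,\cdot\rangle_w$ and $\langle\cdot,\cdot\rangle_{w,\lambda}$. Then, for every $N\ge 0$, there is a constant $C_N(w)>0$, depending only on $N$, $w_-$, $w_+$ and an upper bound for $\|w'\|_{L^\infty}$ (in particular not on $\lambda$), such that $Q_N^{(0)}$ and $Q_N^{(\lambda)}$ exist and are unique and \[ \|Q_N^{(\lambda)}-Q_N^{(0)}\|_{\mathcal B(L^2)}\le C_N(w)\,\lambda\qquad\text{for all }\lambda>0, \] and there is a unitary matrix $U_N\in U(2N+1)$, independent of $\lambda$, such that \[ \max_{1\le k\le 2N+1}\Big\|u_k^{(\lambda)}-\sum_{j=1}^{2N+1}(U_N)_{kj}\,u_j^{(0)}\Big\|_{L^2}\le C_N(w)\,\lambda \qquad\text{for all }\lambda>0. \] -/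

import Mathlib

open MeasureTheory Set
open scoped ENNReal ContDiff ComplexConjugate

namespace S1Model

instance twoPiPos : Fact (0 < 2 * Real.pi) := ⟨Real.two_pi_pos⟩

/-- The circle `ℝ / 2πℤ`. -/
abbrev S1 : Type := AddCircle (2 * Real.pi)

/-- The normalized measure `dθ / 2π` on the circle. -/
noncomputable abbrev μ₀ : Measure S1 := AddCircle.haarAddCircle

/-- The Hilbert space `L²(S¹, dθ/2π)`. -/
abbrev L2 : Type := Lp ℂ 2 μ₀

/-- The Fourier mode `e_n(θ) = exp(i n θ)` as an element of `L²`. -/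
noncomputable abbrev e (n : ℤ) : L2 := fourierLp (T := 2 * Real.pi) 2 n

/-- `w'` is the weak (distributional) derivative of `w` on the circle: integration by parts holds
against every smooth `2π`-periodic test function. -/
def IsWeakDeriv (w w' : S1 → ℝ) : Prop :=
  ∀ φ : ℝ → ℝ, ContDiff ℝ ∞ φ → Function.Periodic φ (2 * Real.pi) →
    ∫ θ in (0 : ℝ)..(2 * Real.pi), w (θ : S1) * deriv φ θ =
      -∫ θ in (0 : ℝ)..(2 * Real.pi), w' (θ : S1) * φ θ

/-- `w ∈ W^{1,∞}(S¹)`, with weak derivative `w'`. -/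
structure IsW1Infty (w w' : S1 → ℝ) : Prop where
  memLp : MemLp w ∞ μ₀
  memLp_deriv : MemLp w' ∞ μ₀
  isWeakDeriv : IsWeakDeriv w w'

/-- The Sobolev space `H¹(S¹)`: `∑ (1 + n²) |f̂(n)|² < ∞`. -/
def H1 : Set L2 :=
  {f | Summable fun n : ℤ => (1 + (n : ℝ) ^ 2) * ‖fourierCoeff (f : S1 → ℂ) n‖ ^ 2}

/-- The derivative `D = ∂_θ`, i.e. `D e_n = i n e_n`, given by `f' = ∑ i n f̂(n) e_n` (a series
converging in `L²` whenever `f ∈ H¹`; it is only used there). -/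
noncomputable def D (f : L2) : L2 :=
  ∑' n : ℤ, (Complex.I * (n : ℂ) * fourierCoeff (f : S1 → ℂ) n) • e n

/-- `⟨f, g⟩_w = ∫ f ḡ w dθ/2π`, on `L²`. -/
noncomputable def weightedForm (w : S1 → ℝ) (f g : L2) : ℂ :=
  ∫ θ, f θ * conj (g θ) * (w θ : ℂ) ∂μ₀

/-- `⟨f, g⟩_{w,lam} = ∫ f ḡ w dθ/2π + lam ∫ f' ḡ' dθ/2π`, on `H¹`. -/
noncomputable def sobolevForm (w : S1 → ℝ) (lam : ℝ) (f g : L2) : ℂ :=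
  weightedForm w f g + (lam : ℂ) * ∫ θ, D f θ * conj (D g θ) ∂μ₀

/-- Trigonometric polynomials of degree at most `N`. -/
noncomputable def trigPoly (N : ℕ) : Submodule ℂ L2 :=
  Submodule.span ℂ (e '' {n : ℤ | |n| ≤ N})

/-- The bounded operator `Q` on `L²` is the orthogonal projector onto `V` for the inner product `B`
with (dense) domain `dom`: `Q f ∈ V` and `f - Q f` is `B`-orthogonal to `V` for all `f` in `dom`.
When `dom` is smaller than `L²`, `Q` is the continuous extension to `L²` of the projector. -/
def IsOrthProjector (B : L2 → L2 → ℂ) (dom : Set L2) (V : Submodule ℂ L2) (Q : L2 →L[ℂ] L2) :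
    Prop :=
  ∀ f ∈ dom, Q f ∈ V ∧ ∀ g ∈ V, B (f - Q f) g = 0

/-- Gram–Schmidt orthogonalization of `v₀, …, v_{m-1}` for the inner product `B` (linear in the
first variable), before normalization:
`g_k = v_k - ∑_{j < k} (⟨v_k, g_j⟩ / ⟨g_j, g_j⟩) g_j`. -/
noncomputable def gramSchmidtAux (B : L2 → L2 → ℂ) {m : ℕ} (v : Fin m → L2) (k : Fin m) : L2 :=
  v k - ∑ j : Finset.Iio k,
    (B (v k) (gramSchmidtAux B v j) / B (gramSchmidtAux B v j) (gramSchmidtAux B v j)) •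
      gramSchmidtAux B v j
termination_by k
decreasing_by all_goals exact Fin.lt_def.1 (Finset.mem_Iio.1 j.2)

/-- The Gram–Schmidt orthonormalization `u_k = g_k / ⟨g_k, g_k⟩^{1/2}`. -/
noncomputable def gramSchmidtBasis (B : L2 → L2 → ℂ) {m : ℕ} (v : Fin m → L2) (k : Fin m) : L2 :=
  (((Real.sqrt (B (gramSchmidtAux B v k) (gramSchmidtAux B v k)).re)⁻¹ : ℝ) : ℂ) •
    gramSchmidtAux B v k

/-- The ordered basis `(e_{-N}, …, e_N)`. -/
noncomputable def modes (N : ℕ) (k : Fin (2 * N + 1)) : L2 := e ((k : ℕ) - (N : ℤ))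

end S1Model

/-! Against a second argument in `trigPoly N`, both forms are given by bounded operators: `⟨f, g⟩_w`
by multiplication `T` by `w`, coercive with constant `wm`, and the Sobolev form by `T + lam • K`,
where `K = freqOp N` is positive and has finite rank because `g` has only modes `|n| ≤ N`
(`inner_D_D`). Positivity of `K` keeps the coercivity constant independent of `lam`.

Everything then reduces to comparing two solutions of a Galerkin problem. If `r = b - a` lies in a
space to which `a` is `T`-orthogonal and `b` is `(T + lam • K)`-orthogonal, testing with `r` gives
`wm ‖r‖² ≤ lam ‖K‖ ‖a‖ ‖r‖` (`norm_sub_le_of_orthogonal`). Residuals `f - Q f` give the projector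
bound. Unnormalized Gram–Schmidt vectors are residuals of `v k` modulo the span of the earlier
vectors, a flag common to both forms. Controlling the normalizing factors (`norm_normalized_sub_le`)
gives the basis bound with `U = 1`. -/

namespace S1Model

/-! ### Perturbation of coercive Galerkin projections -/

section Abstract

variable {E : Type*} [NormedAddCommGroup E] [InnerProductSpace ℂ E]

/-- The operator `T` is coercive with constant `c`. -/
def CoerciveWith (c : ℝ) (T : E →L[ℂ] E) : Prop :=
  ∀ f, c * ‖f‖ ^ 2 ≤ (inner ℂ f (T f)).re

/-- `Q` is the projector onto `V` along the `T`-orthogonal complement of `V`. -/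
def IsProjectorFor (T : E →L[ℂ] E) (V : Submodule ℂ E) (Q : E →L[ℂ] E) : Prop :=
  ∀ f, Q f ∈ V ∧ ∀ g ∈ V, inner ℂ g (T (f - Q f)) = 0

theorem CoerciveWith.eq_zero {c : ℝ} {T : E →L[ℂ] E} (hT : CoerciveWith c T) (hc : 0 < c) {f : E}
    (hf : inner ℂ f (T f) = 0) : f = 0 := by
  have h := hT f
  rw [hf, Complex.zero_re] at h
  have : ‖f‖ ^ 2 ≤ 0 := nonpos_of_mul_nonpos_right h hc
  exact norm_eq_zero.1 (pow_eq_zero_iff two_ne_zero |>.1 (this.antisymm (sq_nonneg _)))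

theorem CoerciveWith.add_smul {c lam : ℝ} {T K : E →L[ℂ] E} (hT : CoerciveWith c T)
    (hK : CoerciveWith 0 K) (hlam : 0 ≤ lam) : CoerciveWith c (T + (lam : ℂ) • K) := by
  intro f
  have h1 := hT f
  have h2 := hK f
  simp only [add_apply, smul_apply, inner_add_right,
    inner_smul_right, Complex.add_re, Complex.re_ofReal_mul]
  nlinarith

theorem IsProjectorFor.ext {c : ℝ} {T : E →L[ℂ] E} (hT : CoerciveWith c T) (hc : 0 < c)
    {V : Submodule ℂ E} {Q Q' : E →L[ℂ] E} (h : IsProjectorFor T V Q)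
    (h' : IsProjectorFor T V Q') : Q = Q' := by
  ext1 f
  have hmem : Q f - Q' f ∈ V := V.sub_mem (h f).1 (h' f).1
  have e1 := (h f).2 _ hmem
  have e2 := (h' f).2 _ hmem
  refine sub_eq_zero.1 (hT.eq_zero hc ?_)
  have : Q f - Q' f = (f - Q' f) - (f - Q f) := by abel
  conv_lhs => rw [this, map_sub, ← this]
  rw [inner_sub_right, e1, e2, sub_zero]

/-- Coercivity makes the compression of `T` to `V` injective, hence invertible in finite dimension;
the projector is the inverse compression applied to `P (T f)`. -/
theorem exists_isProjectorFor {c : ℝ} {T : E →L[ℂ] E} (hT : CoerciveWith c T) (hc : 0 < c)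
    (V : Submodule ℂ E) [FiniteDimensional ℂ V] : ∃ Q, IsProjectorFor T V Q := by
  let P : E →L[ℂ] V := V.orthogonalProjectionOnto
  let A : V →ₗ[ℂ] V := (P ∘L T ∘L V.subtypeL : V →L[ℂ] V)
  have hP : ∀ (g : V) (x : E), inner ℂ g (P x) = inner ℂ (g : E) x := fun g x => by
    simp [P]
  have hA : Function.Injective A := by
    rw [injective_iff_map_eq_zero]
    intro x hx
    have : inner ℂ (x : E) (T x) = 0 := by
      rw [← hP]
      change inner ℂ x (A x) = 0
      rw [hx, inner_zero_right]
    exact Subtype.ext (hT.eq_zero hc this)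
  let S : V →L[ℂ] V := LinearMap.toContinuousLinearMap
    ((LinearEquiv.ofInjectiveEndo A hA).symm : V →ₗ[ℂ] V)
  refine ⟨V.subtypeL ∘L S ∘L P ∘L T, fun f => ⟨(S (P (T f))).2, fun g hg => ?_⟩⟩
  have hS : P (T (S (P (T f)))) = P (T f) :=
    (LinearEquiv.ofInjectiveEndo A hA).apply_symm_apply (P (T f))
  change inner ℂ g (T (f - (S (P (T f)) : E))) = 0
  rw [← hP ⟨g, hg⟩, map_sub, map_sub, hS, sub_self, inner_zero_right]

theorem existsUnique_isProjectorFor {c : ℝ} {T : E →L[ℂ] E} (hT : CoerciveWith c T) (hc : 0 < c)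
    (V : Submodule ℂ E) [FiniteDimensional ℂ V] : ∃! Q, IsProjectorFor T V Q := by
  obtain ⟨Q, hQ⟩ := exists_isProjectorFor hT hc V
  exact ⟨Q, hQ, fun Q' hQ' => hQ'.ext hT hc hQ⟩

/-- For `r = b - a` the two orthogonalities leave `⟨r, (T + lam K) r⟩ = -lam ⟨r, K a⟩`. The left
side dominates `c ‖r‖²` uniformly in `lam`, and one factor `‖r‖` cancels. -/
theorem norm_sub_le_of_orthogonal {c lam : ℝ} {T K : E →L[ℂ] E} (hc : 0 < c)
    (hT : CoerciveWith c T) (hK : CoerciveWith 0 K) (hlam : 0 ≤ lam) {a b : E}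
    (ha : inner ℂ (b - a) (T a) = 0) (hb : inner ℂ (b - a) ((T + (lam : ℂ) • K) b) = 0) :
    ‖b - a‖ ≤ lam * ‖K‖ * ‖a‖ / c := by
  have h1 := hT.add_smul hK hlam (b - a)
  have h2 : inner ℂ (b - a) ((T + (lam : ℂ) • K) (b - a)) =
      -((lam : ℂ) * inner ℂ (b - a) (K a)) := by
    rw [map_sub, inner_sub_right, hb, add_apply, inner_add_right, ha,
      smul_apply, inner_smul_right]
    ring
  rw [h2, Complex.neg_re, Complex.re_ofReal_mul] at h1
  have h3 : -(inner ℂ (b - a) (K a)).re ≤ ‖b - a‖ * (‖K‖ * ‖a‖) :=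
    (neg_le_abs _).trans <| (Complex.abs_re_le_norm _).trans <| (norm_inner_le_norm _ _).trans <|
      mul_le_mul_of_nonneg_left (K.le_opNorm a) (norm_nonneg _)
  have h4 := mul_le_mul_of_nonneg_left h3 hlam
  rw [le_div_iff₀ hc]
  rcases (norm_nonneg (b - a)).eq_or_lt with h0 | h0
  · rw [← h0, zero_mul]; positivity
  · refine le_of_mul_le_mul_left ?_ h0
    linarith

theorem IsProjectorFor.norm_apply_le {c : ℝ} {T : E →L[ℂ] E} (hT : CoerciveWith c T) (hc : 0 < c)
    {V : Submodule ℂ E} {Q : E →L[ℂ] E} (h : IsProjectorFor T V Q) (f : E) :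
    ‖Q f‖ ≤ ‖T‖ * ‖f‖ / c := by
  have h1 := hT (Q f)
  have h2 := (h f).2 _ (h f).1
  rw [map_sub, inner_sub_right, sub_eq_zero] at h2
  rw [← h2] at h1
  have h3 : (inner ℂ (Q f) (T f)).re ≤ ‖Q f‖ * (‖T‖ * ‖f‖) :=
    (Complex.re_le_norm _).trans <| (norm_inner_le_norm _ _).trans <|
      mul_le_mul_of_nonneg_left (T.le_opNorm f) (norm_nonneg _)
  rw [le_div_iff₀ hc]
  rcases (norm_nonneg (Q f)).eq_or_lt with h0 | h0
  · rw [← h0, zero_mul]; positivity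
  · refine le_of_mul_le_mul_left ?_ h0
    linarith

theorem IsProjectorFor.norm_sub_le {c M lam : ℝ} {T K : E →L[ℂ] E} (hc : 0 < c)
    (hT : CoerciveWith c T) (hK : CoerciveWith 0 K) (hlam : 0 ≤ lam) (hM : ‖T‖ ≤ M)
    {V : Submodule ℂ E} {Q Q₀ : E →L[ℂ] E} (h : IsProjectorFor (T + (lam : ℂ) • K) V Q)
    (h₀ : IsProjectorFor T V Q₀) : ‖Q - Q₀‖ ≤ ‖K‖ * (1 + M / c) / c * lam := by
  have hM0 : 0 ≤ M := (norm_nonneg _).trans hM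
  refine ContinuousLinearMap.opNorm_le_bound _ (by positivity) fun f => ?_
  have hmem : (f - Q f) - (f - Q₀ f) ∈ V := by
    rw [sub_sub_sub_cancel_left]
    exact V.sub_mem (h₀ f).1 (h f).1
  have h1 := norm_sub_le_of_orthogonal hc hT hK hlam ((h₀ f).2 _ hmem) ((h f).2 _ hmem)
  rw [sub_sub_sub_cancel_left, norm_sub_rev] at h1
  have h2 : ‖f - Q₀ f‖ ≤ (1 + M / c) * ‖f‖ := by
    have := h₀.norm_apply_le hT hc f
    have h3 : ‖T‖ * ‖f‖ / c ≤ M * ‖f‖ / c := by gcongr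
    calc ‖f - Q₀ f‖ ≤ ‖f‖ + ‖Q₀ f‖ := _root_.norm_sub_le _ _
      _ ≤ ‖f‖ + M * ‖f‖ / c := by linarith
      _ = _ := by ring
  calc ‖(Q - Q₀) f‖ ≤ lam * ‖K‖ * ‖f - Q₀ f‖ / c := h1
    _ ≤ lam * ‖K‖ * ((1 + M / c) * ‖f‖) / c := by gcongr
    _ = _ := by ring

/-- Pythagoras for the energy of `T`: the cross terms vanish, so a residual minimizes the energy in
its coset. -/
theorem re_inner_le_of_orthogonal {c : ℝ} {T : E →L[ℂ] E} (hc : 0 ≤ c) (hT : CoerciveWith c T)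
    (hsymm : (T : E →ₗ[ℂ] E).IsSymmetric) {x y : E} (h : inner ℂ (y - x) (T x) = 0) :
    (inner ℂ x (T x)).re ≤ (inner ℂ y (T y)).re := by
  obtain ⟨r, rfl⟩ : ∃ r, y = x + r := ⟨y - x, by abel⟩
  rw [add_sub_cancel_left] at h
  have h' : inner ℂ x (T r) = 0 := by
    have := hsymm x r
    simp only [ContinuousLinearMap.coe_coe] at this
    rw [← this, ← inner_conj_symm, h, map_zero]
  have h2 := hT r
  rw [map_add, inner_add_left, inner_add_right, inner_add_right, h, h']
  simp only [add_zero, zero_add, Complex.add_re]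
  nlinarith [sq_nonneg ‖r‖]

theorem isSymmetric_add_smul {T K : E →L[ℂ] E} (hTs : (T : E →ₗ[ℂ] E).IsSymmetric)
    (hKs : (K : E →ₗ[ℂ] E).IsSymmetric) (lam : ℝ) :
    ((T + (lam : ℂ) • K : E →L[ℂ] E) : E →ₗ[ℂ] E).IsSymmetric := by
  intro x y
  have h1 := hTs x y
  have h2 := hKs x y
  simp only [ContinuousLinearMap.coe_coe] at h1 h2
  simp only [ContinuousLinearMap.coe_coe, add_apply, smul_apply, inner_add_left, inner_add_right,
    inner_smul_left, inner_smul_right, Complex.conj_ofReal, h1, h2]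

theorem norm_normalized_sub_le {c lam : ℝ} {T K : E →L[ℂ] E} (hc : 0 < c)
    (hT : CoerciveWith c T) (hK : CoerciveWith 0 K)
    (hTs : (T : E →ₗ[ℂ] E).IsSymmetric) (hKs : (K : E →ₗ[ℂ] E).IsSymmetric)
    (hlam : 0 ≤ lam) {a b : E}
    (ha : inner ℂ (b - a) (T a) = 0) (hb : inner ℂ (b - a) ((T + (lam : ℂ) • K) b) = 0) :
    ‖(((Real.sqrt (inner ℂ b ((T + (lam : ℂ) • K) b)).re)⁻¹ : ℝ) : ℂ) • b -
      (((Real.sqrt (inner ℂ a (T a)).re)⁻¹ : ℝ) : ℂ) • a‖ ≤ 2 * ‖K‖ / (c * √c) * lam := by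
  have hr := norm_sub_le_of_orthogonal hc hT hK hlam ha hb
  have hT' := hT.add_smul hK hlam
  have hs' := isSymmetric_add_smul hTs hKs lam
  -- `b` minimizes the perturbed energy and `a` the unperturbed one, whence `h₀ ≤ h₁ ≤ h₀ + lam ‖K‖
  -- ‖a‖²` below.
  have hup : (inner ℂ b ((T + (lam : ℂ) • K) b)).re ≤ (inner ℂ a ((T + (lam : ℂ) • K) a)).re := by
    refine re_inner_le_of_orthogonal hc.le hT' hs' ?_
    rw [← neg_sub, inner_neg_left, hb, neg_zero]
  have hlow := re_inner_le_of_orthogonal hc.le hT hTs ha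
  have hKb : 0 ≤ (inner ℂ b (K b)).re := by simpa using hK b
  have hKa : (inner ℂ a (K a)).re ≤ ‖K‖ * ‖a‖ ^ 2 := by
    refine (Complex.re_le_norm _).trans <| (norm_inner_le_norm _ _).trans ?_
    nlinarith [K.le_opNorm a, norm_nonneg a]
  have hexp : ∀ x : E, (inner ℂ x ((T + (lam : ℂ) • K) x)).re =
      (inner ℂ x (T x)).re + lam * (inner ℂ x (K x)).re := fun x => by
    rw [add_apply, smul_apply, inner_add_right, inner_smul_right, Complex.add_re,
      Complex.re_ofReal_mul]
  have hca := hT a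
  have hcb := hT' b
  set h₁ := (inner ℂ b ((T + (lam : ℂ) • K) b)).re with hh₁
  set h₀ := (inner ℂ a (T a)).re with hh₀
  have h01 : h₀ ≤ h₁ := by rw [hh₁, hexp]; nlinarith
  have h10 : h₁ - h₀ ≤ lam * (‖K‖ * ‖a‖ ^ 2) := by
    have := mul_le_mul_of_nonneg_left hKa hlam
    rw [hexp] at hup
    linarith
  rcases eq_or_ne a 0 with rfl | ha0
  · have : b = 0 := by simpa using hr
    simp only [this, smul_zero, sub_zero, norm_zero]
    positivity
  have hna : 0 < ‖a‖ := norm_pos_iff.2 ha0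
  have hsc : 0 < √c := Real.sqrt_pos.2 hc
  have hh0 : 0 < h₀ := lt_of_lt_of_le (by positivity) hca
  have hs0 : 0 < √h₀ := Real.sqrt_pos.2 hh0
  have hs1 : 0 < √h₁ := Real.sqrt_pos.2 (hh0.trans_le h01)
  have hs01 : √h₀ ≤ √h₁ := Real.sqrt_le_sqrt h01
  have hA : √c * ‖a‖ ≤ √h₀ := by
    apply Real.le_sqrt_of_sq_le
    rw [mul_pow, Real.sq_sqrt hc.le]; exact hca
  have hB : √c * ‖b‖ ≤ √h₁ := by
    apply Real.le_sqrt_of_sq_le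
    rw [mul_pow, Real.sq_sqrt hc.le]; exact hcb
  -- The error splits into a change of normalizing factor and a change of vector; each costs `‖K‖ /
  -- (c √c) * lam`, whence the factor 2.
  have hsplit : (((√h₁)⁻¹ : ℝ) : ℂ) • b - (((√h₀)⁻¹ : ℝ) : ℂ) • a =
      (((√h₁)⁻¹ - (√h₀)⁻¹ : ℝ) : ℂ) • b + (((√h₀)⁻¹ : ℝ) : ℂ) • (b - a) := by
    push_cast
    module
  have hX : ‖(((√h₁)⁻¹ - (√h₀)⁻¹ : ℝ) : ℂ) • b‖ ≤ ‖K‖ / (c * √c) * lam := by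
    rw [norm_smul, Complex.norm_real, Real.norm_eq_abs, abs_sub_comm,
      abs_of_nonneg (sub_nonneg.2 (inv_anti₀ hs0 hs01))]
    -- Here `√h₀ ≤ √h₁ + √h₀` turns the left side into at most `h₁ - h₀`.
    have hd : (√h₁ - √h₀) * √h₀ ≤ lam * (‖K‖ * ‖a‖ ^ 2) := by
      nlinarith [Real.sq_sqrt hh0.le, Real.sq_sqrt (hh0.le.trans h01)]
    have hd2 : (√h₁ - √h₀) / √h₀ ≤ lam * ‖K‖ / c := by
      rw [div_le_div_iff₀ hs0 hc]
      refine le_of_mul_le_mul_right ?_ hs0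
      have h5 : lam * ‖K‖ * (c * ‖a‖ ^ 2) ≤ lam * ‖K‖ * h₀ := by gcongr
      have h6 := mul_le_mul_of_nonneg_left hd hc.le
      have h7 : √h₀ * √h₀ = h₀ := Real.mul_self_sqrt hh0.le
      rw [mul_assoc _ (√h₀), h7]
      linarith
    have hB' : ‖b‖ / √h₁ ≤ 1 / √c := by
      rw [div_le_div_iff₀ hs1 hsc]; linarith
    calc ((√h₀)⁻¹ - (√h₁)⁻¹) * ‖b‖ = (√h₁ - √h₀) / √h₀ * (‖b‖ / √h₁) := by
          field_simp
      _ ≤ lam * ‖K‖ / c * (1 / √c) := by gcongr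
      _ = _ := by field_simp
  have hY : ‖(((√h₀)⁻¹ : ℝ) : ℂ) • (b - a)‖ ≤ ‖K‖ / (c * √c) * lam := by
    rw [norm_smul, Complex.norm_real, Real.norm_eq_abs, abs_of_pos (inv_pos.2 hs0)]
    have hA' : ‖a‖ / √h₀ ≤ 1 / √c := by
      rw [div_le_div_iff₀ hs0 hsc]; linarith
    calc (√h₀)⁻¹ * ‖b - a‖ ≤ (√h₀)⁻¹ * (lam * ‖K‖ * ‖a‖ / c) := by gcongr
      _ = lam * ‖K‖ / c * (‖a‖ / √h₀) := by field_simp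
      _ ≤ lam * ‖K‖ / c * (1 / √c) := by gcongr
      _ = _ := by field_simp
  rw [hsplit]
  calc _ ≤ _ := norm_add_le _ _
    _ ≤ ‖K‖ / (c * √c) * lam + ‖K‖ / (c * √c) * lam := add_le_add hX hY
    _ = _ := by ring

end Abstract

/-! ### Gram–Schmidt vectors as residuals along a flag -/

section GramSchmidt

variable {m : ℕ} {B : L2 → L2 → ℂ} {v : Fin m → L2}

theorem sub_gramSchmidtAux_mem_span (B : L2 → L2 → ℂ) (v : Fin m → L2) (k : Fin m) :
    v k - gramSchmidtAux B v k ∈ Submodule.span ℂ (gramSchmidtAux B v '' Iio k) := by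
  rw [gramSchmidtAux, sub_sub_cancel]
  exact Submodule.sum_mem _ fun j _ => Submodule.smul_mem _ _ <|
    Submodule.subset_span ⟨j, Finset.mem_Iio.1 j.2, rfl⟩

theorem span_image_Iio_le_span_gramSchmidtAux (B : L2 → L2 → ℂ) (v : Fin m → L2) (k : Fin m) :
    Submodule.span ℂ (v '' Iio k) ≤ Submodule.span ℂ (gramSchmidtAux B v '' Iio k) := by
  rw [Submodule.span_le]
  rintro _ ⟨j, hj, rfl⟩
  have h := Submodule.span_mono (image_mono (Iio_subset_Iio (le_of_lt hj)))
    (sub_gramSchmidtAux_mem_span B v j)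
  have h' : gramSchmidtAux B v j ∈ Submodule.span ℂ (gramSchmidtAux B v '' Iio k) :=
    Submodule.subset_span ⟨j, hj, rfl⟩
  simpa using Submodule.add_mem _ h h'

theorem span_gramSchmidtAux_image_Iio_le (B : L2 → L2 → ℂ) (v : Fin m → L2) (k : Fin m) :
    Submodule.span ℂ (gramSchmidtAux B v '' Iio k) ≤ Submodule.span ℂ (v '' Iio k) := by
  induction k using WellFoundedLT.induction with
  | ind k ih =>
    rw [Submodule.span_le]
    rintro _ ⟨j, hj, rfl⟩
    have h := Submodule.span_mono (image_mono (Iio_subset_Iio (le_of_lt hj)))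
      (ih j hj (sub_gramSchmidtAux_mem_span B v j))
    have h' : v j ∈ Submodule.span ℂ (v '' Iio k) := Submodule.subset_span ⟨j, hj, rfl⟩
    simpa using Submodule.sub_mem _ h' h

theorem gramSchmidtAux_mem {V : Submodule ℂ L2} (hv : ∀ k, v k ∈ V) (B : L2 → L2 → ℂ)
    (k : Fin m) : gramSchmidtAux B v k ∈ V := by
  have h := span_gramSchmidtAux_image_Iio_le B v k (sub_gramSchmidtAux_mem_span B v k)
  have hle : Submodule.span ℂ (v '' Iio k) ≤ V := by
    rw [Submodule.span_le]
    rintro _ ⟨j, -, rfl⟩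
    exact hv j
  simpa using V.sub_mem (hv k) (hle h)

theorem inner_gramSchmidtAux_eq_zero {c : ℝ} {T : L2 →L[ℂ] L2} {V : Submodule ℂ L2}
    (hv : ∀ k, v k ∈ V) (hB : ∀ f ∈ V, ∀ g ∈ V, B f g = inner ℂ g (T f))
    (hT : CoerciveWith c T) (hc : 0 < c) (hTs : (T : L2 →ₗ[ℂ] L2).IsSymmetric) {i k : Fin m}
    (hik : i < k) : inner ℂ (gramSchmidtAux B v i) (T (gramSchmidtAux B v k)) = 0 := by
  induction k using WellFoundedLT.induction generalizing i with
  | ind k ih =>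
    have hg := gramSchmidtAux_mem hv B
    have hne : ∀ j, j < k → j ≠ i →
        inner ℂ (gramSchmidtAux B v i) (T (gramSchmidtAux B v j)) = 0 := by
      intro j hj hji
      rcases lt_or_gt_of_ne hji with h | h
      · have hs := hTs (gramSchmidtAux B v i) (gramSchmidtAux B v j)
        simp only [ContinuousLinearMap.coe_coe] at hs
        rw [← hs, ← inner_conj_symm, ih i hik h, map_zero]
      · exact ih j hj h
    rw [gramSchmidtAux.eq_1 B v k]
    simp only [map_sub, map_sum, map_smul, inner_sub_right, inner_sum, inner_smul_right]
    rw [Finset.sum_eq_single (⟨i, Finset.mem_Iio.2 hik⟩ : Finset.Iio k)]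
    · simp only [hB _ (hv k) _ (hg i), hB _ (hg i) _ (hg i)]
      -- A zero denominator forces the Gram–Schmidt vector itself to vanish, so linear independence
      -- of `v` is not needed.
      by_cases h0 : inner ℂ (gramSchmidtAux B v i) (T (gramSchmidtAux B v i)) = 0
      · rw [hT.eq_zero hc h0]; simp
      · rw [div_mul_cancel₀ _ h0, sub_self]
    · intro j _ hj
      rw [hne j (Finset.mem_Iio.1 j.2) (fun h => hj (Subtype.ext h)), mul_zero]
    · simp

theorem inner_span_gramSchmidtAux_eq_zero {c : ℝ} {T : L2 →L[ℂ] L2} {V : Submodule ℂ L2}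
    (hv : ∀ k, v k ∈ V) (hB : ∀ f ∈ V, ∀ g ∈ V, B f g = inner ℂ g (T f))
    (hT : CoerciveWith c T) (hc : 0 < c) (hTs : (T : L2 →ₗ[ℂ] L2).IsSymmetric) {k : Fin m}
    {x : L2} (hx : x ∈ Submodule.span ℂ (v '' Iio k)) :
    inner ℂ x (T (gramSchmidtAux B v k)) = 0 := by
  have hle : Submodule.span ℂ (gramSchmidtAux B v '' Iio k) ≤
      (ℂ ∙ T (gramSchmidtAux B v k))ᗮ := by
    rw [Submodule.span_le]
    rintro _ ⟨i, hi, rfl⟩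
    exact Submodule.mem_orthogonal_singleton_iff_inner_left.2
      (inner_gramSchmidtAux_eq_zero hv hB hT hc hTs hi)
  exact Submodule.mem_orthogonal_singleton_iff_inner_left.1
    (hle (span_image_Iio_le_span_gramSchmidtAux B v k hx))

theorem norm_gramSchmidtBasis_sub_le {c lam : ℝ} {T K : L2 →L[ℂ] L2} {V : Submodule ℂ L2}
    {B' : L2 → L2 → ℂ} (hv : ∀ k, v k ∈ V) (hB : ∀ f ∈ V, ∀ g ∈ V, B f g = inner ℂ g (T f))
    (hB' : ∀ f ∈ V, ∀ g ∈ V, B' f g = inner ℂ g ((T + (lam : ℂ) • K) f))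
    (hc : 0 < c) (hT : CoerciveWith c T) (hK : CoerciveWith 0 K)
    (hTs : (T : L2 →ₗ[ℂ] L2).IsSymmetric) (hKs : (K : L2 →ₗ[ℂ] L2).IsSymmetric)
    (hlam : 0 ≤ lam) (k : Fin m) :
    ‖gramSchmidtBasis B' v k - gramSchmidtBasis B v k‖ ≤ 2 * ‖K‖ / (c * √c) * lam := by
  have hs' := isSymmetric_add_smul hTs hKs lam
  have hmem : gramSchmidtAux B' v k - gramSchmidtAux B v k ∈ Submodule.span ℂ (v '' Iio k) := by
    have h1 := span_gramSchmidtAux_image_Iio_le B v k (sub_gramSchmidtAux_mem_span B v k)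
    have h2 := span_gramSchmidtAux_image_Iio_le B' v k (sub_gramSchmidtAux_mem_span B' v k)
    simpa using Submodule.sub_mem _ h1 h2
  have hg := gramSchmidtAux_mem hv B k
  have hg' := gramSchmidtAux_mem hv B' k
  rw [gramSchmidtBasis, gramSchmidtBasis, hB _ hg _ hg, hB' _ hg' _ hg']
  exact norm_normalized_sub_le hc hT hK hTs hKs hlam
    (inner_span_gramSchmidtAux_eq_zero hv hB hT hc hTs hmem)
    (inner_span_gramSchmidtAux_eq_zero hv hB' (hT.add_smul hK hlam) hc hs' hmem)

end GramSchmidt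

/-! ### Multiplication by the weight -/

section Multiplication

variable {w : S1 → ℝ}

/-- Multiplication by the bounded weight `w` as an operator on `L²`. -/
noncomputable def mulOp (w : S1 → ℝ) (hw : MemLp w ∞ μ₀) : L2 →L[ℂ] L2 :=
  (ContinuousLinearMap.mul ℂ ℂ).holderL μ₀ ∞ 2 2 (hw.ofReal (K := ℂ)).toLp

theorem coeFn_mulOp (hw : MemLp w ∞ μ₀) (f : L2) :
    mulOp w hw f =ᵐ[μ₀] fun θ => (w θ : ℂ) * f θ := by
  refine (ContinuousLinearMap.coeFn_holder (r := 2) (ContinuousLinearMap.mul ℂ ℂ)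
    (hw.ofReal (K := ℂ)).toLp f).trans ?_
  filter_upwards [(hw.ofReal (K := ℂ)).coeFn_toLp] with θ hθ
  rw [ContinuousLinearMap.mul_apply', hθ]
  rfl

theorem weightedForm_eq_inner (hw : MemLp w ∞ μ₀) (f g : L2) :
    weightedForm w f g = inner ℂ g (mulOp w hw f) := by
  rw [weightedForm, L2.inner_def]
  refine integral_congr_ae ?_
  filter_upwards [coeFn_mulOp hw f] with θ hθ
  rw [hθ, RCLike.inner_apply]
  ring

theorem isSymmetric_mulOp (hw : MemLp w ∞ μ₀) : (mulOp w hw : L2 →ₗ[ℂ] L2).IsSymmetric := by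
  intro f g
  simp only [ContinuousLinearMap.coe_coe, L2.inner_def]
  refine integral_congr_ae ?_
  filter_upwards [coeFn_mulOp hw f, coeFn_mulOp hw g] with θ hf hg
  rw [hf, hg, RCLike.inner_apply, RCLike.inner_apply, map_mul, Complex.conj_ofReal]
  ring

theorem coerciveWith_mulOp (hw : MemLp w ∞ μ₀) {c : ℝ} (hc : ∀ᵐ θ ∂μ₀, c ≤ w θ) :
    CoerciveWith c (mulOp w hw) := by
  intro f
  have hi : ∀ g : L2, Integrable (fun θ => (inner ℂ (f θ) (g θ)).re) μ₀ := fun g =>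
    (L2.integrable_inner (𝕜 := ℂ) f g).re
  have h0 : ∀ g : L2, (inner ℂ f g).re = ∫ θ, (inner ℂ (f θ) (g θ)).re ∂μ₀ := fun g => by
    rw [L2.inner_def]
    exact (integral_re (L2.integrable_inner (𝕜 := ℂ) f g)).symm
  have h1 : ‖f‖ ^ 2 = (inner ℂ f f).re := norm_sq_eq_re_inner (𝕜 := ℂ) f
  rw [h1, h0, h0, ← integral_const_mul]
  refine integral_mono_ae ((hi f).const_mul c) (hi _) ?_
  filter_upwards [coeFn_mulOp hw f, hc] with θ hθ hcθ
  rw [hθ, ← smul_eq_mul (w θ : ℂ), inner_smul_right, Complex.re_ofReal_mul]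
  exact mul_le_mul_of_nonneg_right hcθ (inner_self_nonneg (𝕜 := ℂ) (x := f θ))

theorem norm_mulOp_le (hw : MemLp w ∞ μ₀) {M : ℝ} (hM : ∀ᵐ θ ∂μ₀, |w θ| ≤ M) :
    ‖mulOp w hw‖ ≤ M := by
  have hM0 : 0 ≤ M := by
    obtain ⟨θ, hθ⟩ := hM.exists
    exact (abs_nonneg _).trans hθ
  have hW : ‖(hw.ofReal (K := ℂ)).toLp‖ ≤ M := by
    have := Lp.norm_le_of_ae_bound (p := ∞) (f := (hw.ofReal (K := ℂ)).toLp) hM0 (by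
      filter_upwards [(hw.ofReal (K := ℂ)).coeFn_toLp, hM] with θ hθ h
      rw [hθ]
      simpa using h)
    simpa using this
  refine ContinuousLinearMap.opNorm_le_bound _ hM0 fun f => ?_
  refine (ContinuousLinearMap.norm_holder_apply_apply_le _ _ _).trans ?_
  have h1 : ‖ContinuousLinearMap.mul ℂ ℂ‖ ≤ 1 := ContinuousLinearMap.opNorm_mul_le ℂ ℂ
  calc _ ≤ 1 * M * ‖f‖ := by gcongr
    _ = _ := by rw [one_mul]

end Multiplication

/-! ### Fourier side: `H¹`, the derivative and its compression -/

section Fourier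

theorem fourierCoeff_eq_inner (f : L2) (n : ℤ) :
    fourierCoeff (f : S1 → ℂ) n = inner ℂ (e n) f := by
  rw [← fourierBasis_repr, HilbertBasis.repr_apply_apply, coe_fourierBasis]

theorem inner_e_e (m n : ℤ) : inner ℂ (e m) (e n) = if m = n then (1 : ℂ) else 0 :=
  orthonormal_iff_ite.1 orthonormal_fourier m n

/-- The operator `-∂_θ²` compressed to `trigPoly N`. -/
noncomputable def freqOp (N : ℕ) : L2 →L[ℂ] L2 :=
  ∑ n ∈ Finset.Icc (-(N : ℤ)) N, ((n : ℂ) ^ 2) • (innerSL ℂ (e n)).smulRight (e n)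

theorem inner_freqOp (N : ℕ) (f g : L2) : inner ℂ g (freqOp N f) =
    ∑ n ∈ Finset.Icc (-(N : ℤ)) N, (n : ℂ) ^ 2 * (inner ℂ (e n) f * conj (inner ℂ (e n) g)) := by
  simp [freqOp, inner_sum, inner_smul_right]

theorem isSymmetric_freqOp (N : ℕ) : (freqOp N : L2 →ₗ[ℂ] L2).IsSymmetric := by
  intro f g
  simp only [ContinuousLinearMap.coe_coe]
  rw [← inner_conj_symm, inner_freqOp, inner_freqOp, map_sum]
  refine Finset.sum_congr rfl fun n _ => ?_
  simp only [map_mul, map_pow, Complex.conj_conj, map_intCast]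
  ring

theorem coerciveWith_freqOp (N : ℕ) : CoerciveWith 0 (freqOp N) := by
  intro f
  rw [zero_mul, inner_freqOp, Complex.re_sum]
  refine Finset.sum_nonneg fun n _ => ?_
  rw [Complex.mul_conj, ← Complex.ofReal_intCast, ← Complex.ofReal_pow, ← Complex.ofReal_mul,
    Complex.ofReal_re]
  exact mul_nonneg (sq_nonneg _) (Complex.normSq_nonneg _)

instance finiteDimensional_trigPoly (N : ℕ) : FiniteDimensional ℂ (trigPoly N) := by
  refine FiniteDimensional.span_of_finite ℂ (Set.Finite.image _ ?_)
  exact (Set.finite_Icc (-(N : ℤ)) N).subset fun n hn => abs_le.1 hn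

theorem e_mem_trigPoly {N : ℕ} {n : ℤ} (hn : |n| ≤ N) : e n ∈ trigPoly N :=
  Submodule.subset_span ⟨n, hn, rfl⟩

theorem modes_mem_trigPoly (N : ℕ) (k : Fin (2 * N + 1)) : modes N k ∈ trigPoly N := by
  refine e_mem_trigPoly (abs_le.2 ?_)
  have := k.2
  omega

/-- The Sobolev space `H¹` as a submodule. -/
noncomputable def H1Submodule : Submodule ℂ L2 where
  carrier := H1
  zero_mem' := by
    change Summable _
    simp only [fourierCoeff_eq_inner, inner_zero_right]
    simp
  add_mem' := by
    intro f g hf hg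
    change Summable _ at hf hg
    change Summable _
    simp only [fourierCoeff_eq_inner] at *
    refine Summable.of_nonneg_of_le (fun n => by positivity) (fun n => ?_)
      ((hf.add hg).mul_left 2)
    have h : ‖inner ℂ (e n) (f + g)‖ ^ 2 ≤
        2 * (‖inner ℂ (e n) f‖ ^ 2 + ‖inner ℂ (e n) g‖ ^ 2) := by
      rw [inner_add_right]
      exact (pow_le_pow_left₀ (norm_nonneg _) (norm_add_le _ _) 2).trans (add_sq_le)
    calc _ ≤ (1 + (n : ℝ) ^ 2) * (2 * (‖inner ℂ (e n) f‖ ^ 2 + ‖inner ℂ (e n) g‖ ^ 2)) := by gcongr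
      _ = _ := by ring
  smul_mem' := by
    intro a f hf
    change Summable _ at hf
    change Summable _
    simp only [fourierCoeff_eq_inner, inner_smul_right, norm_mul, mul_pow] at *
    refine (hf.mul_left (‖a‖ ^ 2)).congr fun n => ?_
    ring

theorem e_mem_H1 (n : ℤ) : e n ∈ H1 := by
  change Summable _
  simp only [fourierCoeff_eq_inner, inner_e_e]
  refine summable_of_ne_finset_zero (s := {n}) fun m hm => ?_
  rw [if_neg (by simpa using hm)]
  simp

theorem trigPoly_le_H1Submodule (N : ℕ) : trigPoly N ≤ H1Submodule := by
  rw [trigPoly, Submodule.span_le]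
  rintro _ ⟨n, -, rfl⟩
  exact e_mem_H1 n

theorem dense_H1 : Dense H1 := by
  have h : (Submodule.span ℂ (range (fourierLp (T := 2 * Real.pi) 2))).topologicalClosure = ⊤ :=
    span_fourierLp_closure_eq_top (by simp)
  have hd := Submodule.dense_iff_topologicalClosure_eq_top.2 h
  refine hd.mono ?_
  change Submodule.span ℂ _ ≤ H1Submodule
  rw [Submodule.span_le]
  rintro _ ⟨n, rfl⟩
  exact e_mem_H1 n

theorem hasSum_D {f : L2} (hf : f ∈ H1) :
    HasSum (fun n : ℤ => (Complex.I * (n : ℂ) * fourierCoeff (f : S1 → ℂ) n) • e n) (D f) := by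
  refine Summable.hasSum ?_
  have ho := (orthonormal_fourier (T := 2 * Real.pi)).orthogonalFamily
  have := (ho.summable_iff_norm_sq_summable
    (fun n : ℤ => Complex.I * (n : ℂ) * fourierCoeff (f : S1 → ℂ) n)).2 ?_
  · simpa using this
  · refine Summable.of_nonneg_of_le (fun n => by positivity) (fun n => ?_) hf
    rw [norm_mul, norm_mul, Complex.norm_I, one_mul, mul_pow, Complex.norm_intCast, sq_abs]
    gcongr
    linarith

theorem inner_e_D {f : L2} (hf : f ∈ H1) (n : ℤ) :
    inner ℂ (e n) (D f) = Complex.I * n * inner ℂ (e n) f := by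
  have h := (hasSum_D hf).mapL (innerSL ℂ (e n))
  simp only [innerSL_apply_apply, inner_smul_right, inner_e_e] at h
  refine h.unique ?_
  convert hasSum_single n fun m hm => ?_ using 1
  · simp [fourierCoeff_eq_inner]
  · simp [hm.symm]

theorem inner_e_eq_zero_of_mem_trigPoly {N : ℕ} {g : L2} (hg : g ∈ trigPoly N) {n : ℤ}
    (hn : n ∉ Finset.Icc (-(N : ℤ)) N) : inner ℂ (e n) g = 0 := by
  have hle : trigPoly N ≤ (ℂ ∙ e n)ᗮ := by
    rw [trigPoly, Submodule.span_le]
    rintro _ ⟨m, hm, rfl⟩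
    refine Submodule.mem_orthogonal_singleton_iff_inner_right.2 ?_
    rw [inner_e_e, if_neg]
    rintro rfl
    exact hn (Finset.mem_Icc.2 (abs_le.1 hm))
  exact Submodule.mem_orthogonal_singleton_iff_inner_right.1 (hle hg)

/-- Parseval's sum stops at `|n| ≤ N` because `g` has no other modes. The right side is continuous
in `f` for the `L²` norm, though `D` is not. -/
theorem inner_D_D {N : ℕ} {f g : L2} (hf : f ∈ H1) (hg : g ∈ trigPoly N) :
    inner ℂ (D g) (D f) = inner ℂ g (freqOp N f) := by
  have h := (fourierBasis (T := 2 * Real.pi)).hasSum_inner_mul_inner (D g) (D f)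
  rw [coe_fourierBasis] at h
  refine h.unique ?_
  rw [inner_freqOp]
  have hgH := trigPoly_le_H1Submodule N hg
  convert hasSum_sum_of_ne_finset_zero (L := SummationFilter.unconditional ℤ) fun n hn => ?_ using 1
  · refine Finset.sum_congr rfl fun n _ => ?_
    rw [← inner_conj_symm (D g), inner_e_D hf, inner_e_D hgH]
    simp only [map_mul, Complex.conj_I, map_intCast]
    linear_combination ((n : ℂ) ^ 2 * (inner ℂ (e n) f * conj (inner ℂ (e n) g))) * Complex.I_sq
  · rw [← inner_conj_symm (D g), inner_e_D hgH, inner_e_eq_zero_of_mem_trigPoly hg hn]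
    simp

theorem sobolevForm_eq_inner {w : S1 → ℝ} (hw : MemLp w ∞ μ₀) (lam : ℝ) {N : ℕ} {f g : L2}
    (hf : f ∈ H1) (hg : g ∈ trigPoly N) :
    sobolevForm w lam f g = inner ℂ g ((mulOp w hw + (lam : ℂ) • freqOp N) f) := by
  rw [sobolevForm, weightedForm_eq_inner hw, add_apply, smul_apply, inner_add_right,
    inner_smul_right, ← inner_D_D hf hg, L2.inner_def (D g)]
  rfl

end Fourier

/-! ### From form projectors to operator projectors -/

section Projectors

variable {w : S1 → ℝ}

theorem isOrthProjector_weightedForm_iff (hw : MemLp w ∞ μ₀) {V : Submodule ℂ L2}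
    {Q : L2 →L[ℂ] L2} :
    IsOrthProjector (weightedForm w) Set.univ V Q ↔ IsProjectorFor (mulOp w hw) V Q := by
  simp only [IsOrthProjector, IsProjectorFor, weightedForm_eq_inner hw, mem_univ, true_imp_iff]

/-- Both conditions on `Q f` are closed in `L²` once expressed through bounded operators, so they
pass from the dense set `H1` to all of `L²`. -/
theorem isOrthProjector_sobolevForm_iff (hw : MemLp w ∞ μ₀) (lam : ℝ) {N : ℕ}
    {Q : L2 →L[ℂ] L2} :
    IsOrthProjector (sobolevForm w lam) H1 (trigPoly N) Q ↔
      IsProjectorFor (mulOp w hw + (lam : ℂ) • freqOp N) (trigPoly N) Q := by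
  have key : ∀ f ∈ H1, Q f ∈ trigPoly N → ∀ g ∈ trigPoly N, sobolevForm w lam (f - Q f) g =
      inner ℂ g ((mulOp w hw + (lam : ℂ) • freqOp N) (f - Q f)) := fun f hf hQ g hg =>
    sobolevForm_eq_inner hw lam
      (H1Submodule.sub_mem hf (trigPoly_le_H1Submodule N hQ)) hg
  constructor
  · intro h
    have hmem : ∀ f, Q f ∈ trigPoly N := fun f =>
      ((trigPoly N).closed_of_finiteDimensional.preimage Q.continuous).closure_subset_iff.2
        (fun f hf => (h f hf).1) (dense_H1 f)
    refine fun f => ⟨hmem f, fun g hg => ?_⟩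
    have hc : IsClosed {f | inner ℂ g ((mulOp w hw + (lam : ℂ) • freqOp N) (f - Q f)) = 0} :=
      isClosed_eq (by fun_prop) continuous_const
    refine hc.closure_subset_iff.2 (fun f hf => ?_) (dense_H1 f)
    exact (key f hf (hmem f) g hg).symm.trans ((h f hf).2 g hg)
  · intro h f hf
    exact ⟨(h f).1, fun g hg => (key f hf (h f).1 g hg).trans ((h f).2 g hg)⟩

end Projectors

end S1Model

theorem mainTheorem9 (N : ℕ) (wm wp L : ℝ) (hwm : 0 < wm) :
    ∃ C : ℝ, 0 < C ∧ ∀ w w' : S1Model.S1 → ℝ, S1Model.IsW1Infty w w' →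
      (∀ᵐ θ ∂S1Model.μ₀, wm ≤ w θ ∧ w θ ≤ wp) →
      (∀ᵐ θ ∂S1Model.μ₀, |w' θ| ≤ L) →
        (∃! Q₀ : S1Model.L2 →L[ℂ] S1Model.L2,
          S1Model.IsOrthProjector (S1Model.weightedForm w) Set.univ (S1Model.trigPoly N) Q₀) ∧
        (∀ lam : ℝ, 0 < lam → ∃! Q : S1Model.L2 →L[ℂ] S1Model.L2,
          S1Model.IsOrthProjector (S1Model.sobolevForm w lam) S1Model.H1
            (S1Model.trigPoly N) Q) ∧
        (∀ lam : ℝ, 0 < lam → ∀ Q Q₀ : S1Model.L2 →L[ℂ] S1Model.L2,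
          S1Model.IsOrthProjector (S1Model.sobolevForm w lam) S1Model.H1
            (S1Model.trigPoly N) Q →
          S1Model.IsOrthProjector (S1Model.weightedForm w) Set.univ (S1Model.trigPoly N) Q₀ →
          ‖Q - Q₀‖ ≤ C * lam) ∧
        ∃ U ∈ Matrix.unitaryGroup (Fin (2 * N + 1)) ℂ, ∀ lam : ℝ, 0 < lam →
          ∀ k : Fin (2 * N + 1),
            ‖S1Model.gramSchmidtBasis (S1Model.sobolevForm w lam) (S1Model.modes N) k -
                ∑ j : Fin (2 * N + 1), U k j •
                  S1Model.gramSchmidtBasis (S1Model.weightedForm w) (S1Model.modes N) j‖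
              ≤ C * lam := by
  set C₁ := ‖S1Model.freqOp N‖ * (1 + wp / wm) / wm with hC₁
  set C₂ := 2 * ‖S1Model.freqOp N‖ / (wm * √wm) with hC₂
  -- The `1` keeps the constant positive, for instance when `N = 0` and `freqOp` vanishes.
  refine ⟨max 1 (max C₁ C₂), lt_max_of_lt_left one_pos, fun w w' hw hbd _ => ?_⟩
  have hcoer := S1Model.coerciveWith_mulOp hw.memLp (hbd.mono fun θ h => h.1)
  have hK := S1Model.coerciveWith_freqOp N
  have hnorm : ‖S1Model.mulOp w hw.memLp‖ ≤ wp := by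
    refine S1Model.norm_mulOp_le hw.memLp (hbd.mono fun θ h => ?_)
    rw [abs_of_pos (hwm.trans_le h.1)]
    exact h.2
  simp only [S1Model.isOrthProjector_weightedForm_iff hw.memLp,
    S1Model.isOrthProjector_sobolevForm_iff hw.memLp]
  refine ⟨S1Model.existsUnique_isProjectorFor hcoer hwm _, fun lam hlam =>
    S1Model.existsUnique_isProjectorFor (hcoer.add_smul hK hlam.le) hwm _,
    fun lam hlam Q Q₀ hQ hQ₀ => ?_, 1, one_mem _, fun lam hlam k => ?_⟩
  · refine (hQ.norm_sub_le hwm hcoer hK hlam.le hnorm hQ₀).trans ?_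
    gcongr
    exact (le_max_left _ _).trans (le_max_right _ _)
  · simp only [Matrix.one_apply, ite_smul, one_smul, zero_smul, Finset.sum_ite_eq,
      Finset.mem_univ, if_true]
    refine (S1Model.norm_gramSchmidtBasis_sub_le (S1Model.modes_mem_trigPoly N)
      (fun f _ g _ => S1Model.weightedForm_eq_inner hw.memLp f g)
      (fun f hf g hg => S1Model.sobolevForm_eq_inner hw.memLp lam
        (S1Model.trigPoly_le_H1Submodule N hf) hg) hwm hcoer hK
      (S1Model.isSymmetric_mulOp hw.memLp) (S1Model.isSymmetric_freqOp N) hlam.le k).trans ?_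
    gcongr
    exact (le_max_right _ _).trans (le_max_right _ _)
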